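/- Let $d_A,d_B,k\ge 1$ be integers, $d=d_Ad_B$, and let $\mathrm{SEP}$ be the set of separable states of $\mathbb{C}^{d_A}\otimes\mathbb{C}^{d_B}$, i.e. the convex hull of the products $\sigma\otimes\tau$ of density matrices. Let $\pi_{d,k}$ be the law of $\rho=\mathrm{tr}_R|\phi\rangle\langle\phi|$, where $\phi$ is a uniformly distributed unit vector of $\mathbb{C}^{d}\otimes\mathbb{C}^k$ and $\mathrm{tr}_R$ is the partial trace over $\mathbb{C}^k$. An entanglement witness is a Hermitian $d\times d$ matrix $W$ with $\mathrm{tr}(W\rho)\ge 0$ for all $\rho\in\mathrm{SEP}$. Let $\emptyset\ne\Theta\subset[-1,1]^M$ and let $\mathcal{M}$ map each $\theta\in\Theta$ to an entanglement witness $\mathcal{M}(\theta)$ with Frobenius norm $\|\mathcal{M}(\theta)\|_F=1$, such that $$\|\mathcal{M}(\theta)-\mathcal{M}(\theta')\|_F\le l\,\|\theta-\theta'\|_2\qquad(\theta,\theta'\in\Theta).$$ Let $$\alpha_{\min}=\inf_{\theta\in\Theta}\frac{\mathrm{tr}\,\mathcal{M}(\theta)}{\sqrt{\mathrm{tr}(\mathcal{M}(\theta)^2)}}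 .$$ Then $\alpha_{\min}=\inf_{\theta\in\Theta}\mathrm{tr}\,\mathcal{M}(\theta)\ge 1$, and for every $0<\epsilon<1$ with $2\sqrt{M}\,l\,d/\epsilon\ge 1$, $$\Pr_{\rho\sim\pi_{d,k}}\bigl[\exists\,\theta\in\Theta:\ \mathrm{tr}(\rho\,\mathcal{M}(\theta))<0\bigr]<2\,e^{C_1-C_2k},\qquad C_1=M\ln\frac{2\sqrt{M}\,l\,d}{\epsilon},\quad C_2=\bigl(\sqrt{1+\alpha_{\min}-\epsilon}-1\bigr)^2 .$$ For $\epsilon=\tfrac12$ the constants are $C_1=M\ln(4\sqrt{M}\,l\,d)$ and $C_2=(\sqrt{0.5+\alpha_{\min}}-1)^2$. -/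

import Mathlib

open MeasureTheory
open scoped Kronecker ComplexOrder

noncomputable section

namespace EntanglementDetection

/-- Density matrices: positive semidefinite complex matrices of trace one. -/
def IsDensityMatrix {n : Type*} [Fintype n] (ρ : Matrix n n ℂ) : Prop :=
  ρ.PosSemidef ∧ ρ.trace = 1

/-- The set `SEP` of separable states of a bipartite system `A ⊗ B`: convex combinations of
products of density matrices of the two parties. -/
def separableStates (A B : Type*) [Fintype A] [Fintype B] : Set (Matrix (A × B) (A × B) ℂ) :=
  convexHull ℝ {ρ | ∃ (σ : Matrix A A ℂ) (τ : Matrix B B ℂ),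
    IsDensityMatrix σ ∧ IsDensityMatrix τ ∧ ρ = σ ⊗ₖ τ}

/-- Entanglement witnesses: observables (Hermitian matrices) whose expectation is nonnegative in
every separable state. (The trace is a real number here; `.re` reads it as one.) -/
def IsEntanglementWitness {A B : Type*} [Fintype A] [Fintype B]
    (W : Matrix (A × B) (A × B) ℂ) : Prop :=
  W.IsHermitian ∧ ∀ ρ ∈ separableStates A B, 0 ≤ (ρ * W).trace.re

/-- The Frobenius norm `√(∑ i j, |A i j|²)`. -/
def frobeniusNorm {n : Type*} [Fintype n] (A : Matrix n n ℂ) : ℝ :=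
  √(∑ i, ∑ j, ‖A i j‖ ^ 2)

/-- The projector `|ψ⟩⟨ψ|` of a vector `ψ`. -/
def pureState {n : Type*} (ψ : EuclideanSpace ℂ n) : Matrix n n ℂ :=
  Matrix.of fun i j => ψ i * star (ψ j)

/-- The partial trace over the second tensor factor. -/
def partialTrace {n r : Type*} [Fintype r] (X : Matrix (n × r) (n × r) ℂ) : Matrix n n ℂ :=
  Matrix.of fun i j => ∑ a, X (i, a) (j, a)

/-- The uniform probability measure on the unit sphere of `ℂⁿ` (the law of a Haar random pure
state): the normalized surface measure. -/
def uniformPureState (n : Type*) [Fintype n] :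
    Measure (Metric.sphere (0 : EuclideanSpace ℂ n) 1) :=
  ((volume : Measure (EuclideanSpace ℂ n)).toSphere Set.univ)⁻¹ •
    (volume : Measure (EuclideanSpace ℂ n)).toSphere

/-- The entrywise (Borel) σ-algebra on complex matrices. -/
instance matrixMeasurableSpace {n : Type*} : MeasurableSpace (Matrix n n ℂ) :=
  MeasurableSpace.pi

/-- The distribution `π_{d,k}` of density matrices on a system with index set `n`, `d = |n|`,
induced by a `k`-dimensional environment: the law of `tr_R |φ⟩⟨φ|` for a Haar random pure state
`φ` of the system and the environment `R`. -/
def inducedDistribution (n : Type*) [Fintype n] (k : ℕ) : Measure (Matrix n n ℂ) :=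
  (uniformPureState (n × Fin k)).map fun φ => partialTrace (pureState φ.1)

/-- The map that is pushed forward in `inducedDistribution` is measurable. -/
theorem measurable_reducedState (n : Type*) [Fintype n] (k : ℕ) :
    Measurable fun φ : Metric.sphere (0 : EuclideanSpace ℂ (n × Fin k)) 1 =>
      partialTrace (pureState φ.1) := by
  refine measurable_pi_lambda _ fun i => measurable_pi_lambda _ fun j => ?_
  apply Continuous.measurable
  simp only [partialTrace, pureState, Matrix.of_apply]
  fun_prop

/-- A (normalized) parameterized entanglement witness with `m` real parameters and feasible
parameter set `Θ ⊆ [-1,1]ᵐ`. -/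
structure IsParameterizedEW {A B : Type*} [Fintype A] [Fintype B] {m : ℕ}
    (Θ : Set (EuclideanSpace ℝ (Fin m)))
    (𝓜 : EuclideanSpace ℝ (Fin m) → Matrix (A × B) (A × B) ℂ) : Prop where
  mem_cube : ∀ θ ∈ Θ, ∀ i, θ i ∈ Set.Icc (-1 : ℝ) 1
  witness : ∀ θ ∈ Θ, IsEntanglementWitness (𝓜 θ)
  normalized : ∀ θ ∈ Θ, frobeniusNorm (𝓜 θ) = 1

/-- The detection capability of a parameterized entanglement witness: the probability that a state
with law `π_{d,k}` is detected by some admissible parameter. -/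
def detectionCapability {A B : Type*} [Fintype A] [Fintype B] {m : ℕ} (k : ℕ)
    (Θ : Set (EuclideanSpace ℝ (Fin m)))
    (𝓜 : EuclideanSpace ℝ (Fin m) → Matrix (A × B) (A × B) ℂ) : ℝ :=
  (inducedDistribution (A × B) k).real {ρ | ∃ θ ∈ Θ, (ρ * 𝓜 θ).trace.re < 0}

/-- `α_min`, the infimum over `θ ∈ Θ` of `tr(𝓜 θ) / √(tr((𝓜 θ)²))`. -/
def alphaMin {A B : Type*} [Fintype A] [Fintype B] {m : ℕ}
    (Θ : Set (EuclideanSpace ℝ (Fin m)))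
    (𝓜 : EuclideanSpace ℝ (Fin m) → Matrix (A × B) (A × B) ℂ) : ℝ :=
  sInf ((fun θ => (𝓜 θ).trace.re / √((𝓜 θ * 𝓜 θ).trace.re)) '' Θ)

end EntanglementDetection

end

/-!
There are three ingredients.

*Witnesses have trace at least their Frobenius norm*
(`IsEntanglementWitness.frobeniusNorm_le_trace`, dual to the theorem of Gurvits and Barnum on the
separable ball). Write a witness `W` as a matrix of blocks `W_{ij}`. Positivity on product vectors
says that `(⟨y, W_{ij} y⟩)_{ij}` is positive semidefinite for all `y`, so
`|⟨y, W_{ij} y⟩|² ≤ ⟨y, W_{ii} y⟩ ⟨y, W_{jj} y⟩`. The trace norm of `W_{ij}` is `|tr (W_{ij} U)|` for a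
unitary `U`; expanding this trace in an eigenbasis of `U` and applying the Cauchy–Schwarz inequality
gives `‖W_{ij}‖_F² ≤ tr W_{ii} * tr W_{jj}` (`sum_norm_sq_le_of_numericalRange`). Summing over
`i, j` gives `‖W‖_F² ≤ (tr W)²`. Hence `α_min ≥ 1`.

*A Chernoff bound for one observable* (`uniformPureState_expectation_neg_le`). The event
`tr (ρ A) < 0` says that the quadratic form of `A ⊗ 1` is negative at `φ`. It is invariant under
scaling, so `φ` may be replaced by a Gaussian vector, and the exponential moment of the form is
`∏ (1 + t μ_p)⁻¹` over the eigenvalues `μ_p`. With `log (1 + u) ≥ u - u² / (2 (1 - t))` and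
`t = 1 - 1 / √(1 + a)` the bound becomes `exp (-(√(1 + a) - 1)² k)` for `‖A‖_F ≤ 1`, `tr A ≥ a`.

*A covering argument* (`detectionCapability_le`). The cube `[-1, 1]ᵐ` is cut into `N ^ m` cells with
`N = ⌈√m l d / ε⌉`, each contained in a ball of radius `√m / N ≤ ε / (l d)` about its centre. The
centres need not be parameters in `Θ`, but the one-point Kirszbraun extension
(`exists_mem_forall_norm_sub_le`) provides for each cell a Hermitian matrix `W` within `ε / d` of all
`𝓜 θ` of that cell, with `‖W‖_F ≤ 1` and `tr W ≥ α_min`. A state detected by some `𝓜 θ` of the cell has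
negative expectation in `W - (ε / d) 1`, which has norm at most `1` and trace at least `α_min - ε`.
The union bound then gives the estimate without the factor `2`, because `N ≤ 2 √m l d / ε`; that
factor makes the inequality strict.
-/

namespace EntanglementDetection

open Matrix

/-! ### One-point Kirszbraun extension -/

/-- The parallel axis identity: the second moment of a weighted family about `w` is its variance
`∑ pᵢ ‖aᵢ‖² - ‖∑ pᵢ aᵢ‖²` plus the squared distance from its mean to `w`. -/
theorem sum_mul_norm_sub_sq {ι H : Type*} [Fintype ι] [NormedAddCommGroup H]
    [InnerProductSpace ℝ H] {p : ι → ℝ} (hp : ∑ i, p i = 1) (a : ι → H) (w : H) :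
    ∑ i, p i * ‖a i - w‖ ^ 2 =
      (∑ i, p i * ‖a i‖ ^ 2 - ‖∑ i, p i • a i‖ ^ 2) + ‖∑ i, p i • a i - w‖ ^ 2 := by
  have h1 : ∀ i, p i * ‖a i - w‖ ^ 2 =
      p i * ‖a i‖ ^ 2 - 2 * inner ℝ (p i • a i) w + p i * ‖w‖ ^ 2 := fun i => by
    rw [norm_sub_sq_real, real_inner_smul_left]
    ring
  simp only [h1, Finset.sum_add_distrib, Finset.sum_sub_distrib, ← Finset.sum_mul, hp,
    ← Finset.mul_sum, ← sum_inner]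
  rw [norm_sub_sq_real (∑ i, p i • a i)]
  ring

/-- The variance as half the mean squared distance of two independent samples. This form passes
a Lipschitz bound on the points to a bound on the variances. -/
theorem sum_sum_mul_norm_sub_sq {ι H : Type*} [Fintype ι] [NormedAddCommGroup H]
    [InnerProductSpace ℝ H] {p : ι → ℝ} (hp : ∑ i, p i = 1) (a : ι → H) :
    ∑ j, p j * ∑ i, p i * ‖a i - a j‖ ^ 2 =
      2 * (∑ i, p i * ‖a i‖ ^ 2 - ‖∑ i, p i • a i‖ ^ 2) := by
  have h := sum_mul_norm_sub_sq hp a (∑ i, p i • a i)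
  simp only [sub_self, norm_zero] at h
  simp only [fun j => sum_mul_norm_sub_sq hp a (a j), mul_add, Finset.sum_add_distrib,
    ← Finset.sum_mul, hp]
  simp only [norm_sub_rev (∑ i, p i • a i)]
  linarith

/-- One-point Kirszbraun extension for finitely many points, with the new value in the convex hull
of the old ones. The weights are those that maximize the variance of the family `a`: stationarity
makes every `a i` lie within one standard deviation of the mean, and the variance of `a` is at most
`l ^ 2` times that of `b`. -/
theorem exists_mem_stdSimplex_norm_sub_le {ι E H : Type*} [Fintype ι] [Nonempty ι]
    [NormedAddCommGroup E] [InnerProductSpace ℝ E]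
    [NormedAddCommGroup H] [InnerProductSpace ℝ H] {a : ι → H} {b : ι → E} {l δ : ℝ}
    (hl : 0 ≤ l) (hδ : 0 ≤ δ) (hab : ∀ i j, ‖a i - a j‖ ≤ l * ‖b i - b j‖) {c : E}
    (hb : ∀ i, ‖b i - c‖ ≤ δ) :
    ∃ p ∈ stdSimplex ℝ ι, ∀ i, ‖a i - ∑ j, p j • a j‖ ≤ l * δ := by
  classical
  let V : (ι → ℝ) → ℝ := fun p => ∑ i, p i * ‖a i‖ ^ 2 - ‖∑ i, p i • a i‖ ^ 2
  obtain ⟨i₀⟩ := ‹Nonempty ι›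
  obtain ⟨p, hp, hmax⟩ := (isCompact_stdSimplex ℝ ι).exists_isMaxOn
    ⟨_, single_mem_stdSimplex ℝ i₀⟩ (f := V) (by fun_prop)
  refine ⟨p, hp, fun i => ?_⟩
  set w := ∑ j, p j • a j with hw
  have hV : V p ≤ (l * δ) ^ 2 := by
    have h1 := sum_sum_mul_norm_sub_sq hp.2 a
    have h2 := sum_sum_mul_norm_sub_sq hp.2 b
    have h3 := sum_mul_norm_sub_sq hp.2 b c
    have h4 : ∑ j, p j * ∑ i, p i * ‖a i - a j‖ ^ 2 ≤
        l ^ 2 * ∑ j, p j * ∑ i, p i * ‖b i - b j‖ ^ 2 := by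
      simp only [Finset.mul_sum]
      refine Finset.sum_le_sum fun j _ => Finset.sum_le_sum fun i _ => ?_
      have := pow_le_pow_left₀ (norm_nonneg _) (hab i j) 2
      calc p j * (p i * ‖a i - a j‖ ^ 2) ≤ p j * (p i * (l * ‖b i - b j‖) ^ 2) := by
            gcongr
            · exact hp.1 j
            · exact hp.1 i
        _ = _ := by ring
    have h5 : ∑ i, p i * ‖b i - c‖ ^ 2 ≤ δ ^ 2 := by
      calc ∑ i, p i * ‖b i - c‖ ^ 2 ≤ ∑ i, p i * δ ^ 2 := by
            gcongr with i
            · exact hp.1 i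
            · exact hb i
        _ = δ ^ 2 := by rw [← Finset.sum_mul, hp.2, one_mul]
    have h6 : ∑ i, p i * ‖b i‖ ^ 2 - ‖∑ i, p i • b i‖ ^ 2 ≤ δ ^ 2 := by
      have := sq_nonneg ‖∑ i, p i • b i - c‖
      linarith
    have h7 := mul_le_mul_of_nonneg_left h6 (sq_nonneg l)
    rw [h2] at h4
    change ∑ i, p i * ‖a i‖ ^ 2 - ‖∑ i, p i • a i‖ ^ 2 ≤ _
    rw [mul_pow]
    linarith
  -- Moving mass `t` onto the point `i` cannot increase the variance.
  have hfirst : ∀ t ∈ Set.Ioo (0 : ℝ) 1, (1 - t) * ‖a i - w‖ ^ 2 ≤ V p := by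
    rintro t ⟨ht0, ht1⟩
    let q : ι → ℝ := (1 - t) • p + t • Pi.single i 1
    have hq : q ∈ stdSimplex ℝ ι := convex_stdSimplex ℝ ι hp (single_mem_stdSimplex ℝ i)
      (by linarith) ht0.le (by ring)
    have hs : ∑ j, q j • a j = (1 - t) • w + t • a i := by
      simp [q, add_smul, Finset.sum_add_distrib, mul_smul, ← Finset.smul_sum, hw, Pi.single_apply,
        ite_smul]
    have hs2 : ∑ j, q j * ‖a j - w‖ ^ 2 = (1 - t) * V p + t * ‖a i - w‖ ^ 2 := by
      have h1 := sum_mul_norm_sub_sq hp.2 a w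
      rw [← hw, sub_self, norm_zero] at h1
      have h2 : V p = ∑ i, p i * ‖a i - w‖ ^ 2 := by
        rw [h1]; simp [V, hw]
      rw [h2]
      simp [q, add_mul, Finset.sum_add_distrib, mul_assoc, ← Finset.mul_sum, Pi.single_apply]
    have h1 := sum_mul_norm_sub_sq hq.2 a w
    have h2 : V q ≤ V p := hmax hq
    have h3 : (1 - t) • w + t • a i - w = t • (a i - w) := by module
    rw [hs2, hs, h3, norm_smul, Real.norm_of_nonneg ht0.le, mul_pow] at h1
    have h4 : V q = ∑ j, q j * ‖a j‖ ^ 2 - ‖(1 - t) • w + t • a i‖ ^ 2 := by simp only [V, hs]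
    rw [← h4] at h1
    have h5 : t * ((1 - t) * ‖a i - w‖ ^ 2) ≤ t * V p := by linarith
    exact le_of_mul_le_mul_left h5 ht0
  have hD : ‖a i - w‖ ^ 2 ≤ V p := by
    have hlim : Filter.Tendsto (fun t : ℝ => (1 - t) * ‖a i - w‖ ^ 2) (nhdsWithin 0 (Set.Ioi 0))
        (nhds ((1 - 0) * ‖a i - w‖ ^ 2)) :=
      ((by fun_prop : Continuous fun t : ℝ => (1 - t) * ‖a i - w‖ ^ 2).tendsto 0).mono_left
        nhdsWithin_le_nhds
    have := le_of_tendsto hlim (Filter.eventually_of_mem (Ioo_mem_nhdsGT one_pos) hfirst)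
    simpa using this
  exact (le_abs_self _).trans (abs_le_of_sq_le_sq (hD.trans hV) (by positivity))

/-- One-point Kirszbraun extension: if the `l`-Lipschitz map `f` sends a subset of a ball of
radius `δ` into the compact convex set `K`, then some point of `K` is within `l * δ` of all its
values. The case of infinitely many points follows from the finite one by compactness of `K`. -/
theorem exists_mem_forall_norm_sub_le {E H : Type*}
    [NormedAddCommGroup E] [InnerProductSpace ℝ E]
    [NormedAddCommGroup H] [InnerProductSpace ℝ H] {K : Set H} (hK : IsCompact K)
    (hKc : Convex ℝ K) (hKn : K.Nonempty) {T : Set E} {f : E → H} (hf : ∀ θ ∈ T, f θ ∈ K)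
    {l δ : ℝ} (hl : 0 ≤ l) (hδ : 0 ≤ δ)
    (hlip : ∀ θ ∈ T, ∀ θ' ∈ T, ‖f θ - f θ'‖ ≤ l * ‖θ - θ'‖) {c : E}
    (hc : ∀ θ ∈ T, ‖θ - c‖ ≤ δ) :
    ∃ w ∈ K, ∀ θ ∈ T, ‖f θ - w‖ ≤ l * δ := by
  have h : (K ∩ ⋂ θ : T, Metric.closedBall (f θ) (l * δ)).Nonempty := by
    refine hK.inter_iInter_nonempty _ (fun _ => Metric.isClosed_closedBall) fun u => ?_
    rcases u.eq_empty_or_nonempty with rfl | hu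
    · simpa using hKn
    have : Nonempty u := hu.to_subtype
    obtain ⟨p, hp, hpw⟩ := exists_mem_stdSimplex_norm_sub_le (ι := u)
      (a := fun i => f i.1.1) (b := fun i => i.1.1) hl hδ
      (fun i j => hlip _ i.1.2 _ j.1.2) (c := c) (fun i => hc _ i.1.2)
    refine ⟨∑ j, p j • f j.1.1, hKc.sum_mem (fun i _ => hp.1 i) hp.2 (fun i _ => hf _ i.1.2), ?_⟩
    simp only [Set.mem_iInter, Metric.mem_closedBall]
    intro θ hθ
    rw [dist_comm, dist_eq_norm]
    exact hpw ⟨θ, hθ⟩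
  obtain ⟨w, hw, hw'⟩ := h
  refine ⟨w, hw, fun θ hθ => ?_⟩
  have := Set.mem_iInter.1 hw' ⟨θ, hθ⟩
  rwa [Metric.mem_closedBall, dist_comm, dist_eq_norm] at this

/-! ### Trace and Frobenius norm of entanglement witnesses -/

open Module Module.End in
/-- A unitary operator has an orthonormal eigenbasis: a joint eigenbasis of the commuting symmetric
operators `U + U⁻¹` and `i (U - U⁻¹)`. -/
theorem exists_orthonormalBasis_eigenvectors {E : Type*} [NormedAddCommGroup E]
    [InnerProductSpace ℂ E] [FiniteDimensional ℂ E] (U : E ≃ₗᵢ[ℂ] E) :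
    ∃ (y : OrthonormalBasis (Fin (finrank ℂ E)) ℂ E) (c : Fin (finrank ℂ E) → ℂ),
      ∀ k, U (y k) = c k • y k := by
  classical
  let T : E →ₗ[ℂ] E := U.toLinearEquiv.toLinearMap
  let S : E →ₗ[ℂ] E := U.symm.toLinearEquiv.toLinearMap
  have hT : ∀ x, T x = U x := fun _ => rfl
  have hS : ∀ x, S x = U.symm x := fun _ => rfl
  have hA : (T + S).IsSymmetric := fun x y => by
    simp only [LinearMap.add_apply, hT, hS, inner_add_left, inner_add_right,
      LinearIsometryEquiv.inner_map_eq_flip, LinearIsometryEquiv.symm_symm]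
    ring
  have hB : (Complex.I • (T - S)).IsSymmetric := fun x y => by
    simp only [LinearMap.smul_apply, LinearMap.sub_apply, hT, hS, inner_sub_left, inner_sub_right,
      inner_smul_left, inner_smul_right,
      LinearIsometryEquiv.inner_map_eq_flip, LinearIsometryEquiv.symm_symm, Complex.conj_I]
    ring
  have hAB : Commute (T + S) (Complex.I • (T - S)) := by
    refine Commute.smul_right ?_ _
    have hTS : Commute T S := by
      ext x
      simp [hT, hS]
    exact ((Commute.refl T).add_left hTS.symm).sub_right (hTS.add_left (Commute.refl S))
  have hint := DirectSum.isInternal_ne_bot_iff.2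
    (LinearMap.IsSymmetric.directSum_isInternal_of_commute hA hB hAB)
  have horth := (LinearMap.IsSymmetric.orthogonalFamily_eigenspace_inf_eigenspace hA hB)
  have hfin := WellFoundedGT.finite_ne_bot_of_iSupIndep horth.independent
  have : Fintype {i : ℂ × ℂ //
      eigenspace (T + S) i.2 ⊓ eigenspace (Complex.I • (T - S)) i.1 ≠ ⊥} := hfin.fintype
  have horth' := horth.comp (Subtype.val_injective (p := fun i : ℂ × ℂ =>
      eigenspace (T + S) i.2 ⊓ eigenspace (Complex.I • (T - S)) i.1 ≠ ⊥))
  let b := hint.subordinateOrthonormalBasis rfl horth'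
  have hmem := fun a => hint.subordinateOrthonormalBasis_subordinate rfl a horth'
  refine ⟨b, fun k => ((hint.subordinateOrthonormalBasisIndex rfl k horth').1.2
    - Complex.I * (hint.subordinateOrthonormalBasisIndex rfl k horth').1.1) / 2, fun k => ?_⟩
  have h1 : (T + S) (b k) = _ • b k := mem_eigenspace_iff.1 (hmem k).1
  have h2 : (Complex.I • (T - S)) (b k) = _ • b k := mem_eigenspace_iff.1 (hmem k).2
  have : U (b k) = (1 / 2 : ℂ) • ((T + S) (b k) - Complex.I • (Complex.I • (T - S)) (b k)) := by
    simp only [LinearMap.add_apply, LinearMap.smul_apply, LinearMap.sub_apply, smul_smul,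
      Complex.I_mul_I, hT, hS]
    module
  rw [this, h1, h2]
  module

open Module in
/-- The Hilbert–Schmidt norm of `X` is at most its trace norm, and the latter is the trace of
`X ∘ U` for a unitary `U`. Here `v` is an orthonormal basis of right singular vectors and `U` takes
the left singular vectors to it. -/
theorem exists_linearIsometryEquiv_sum_norm_sq_le {E : Type*} [NormedAddCommGroup E]
    [InnerProductSpace ℂ E] [FiniteDimensional ℂ E] (X : E →ₗ[ℂ] E) :
    ∃ (U : E ≃ₗᵢ[ℂ] E) (v : OrthonormalBasis (Fin (finrank ℂ E)) ℂ E),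
      ∑ i, ‖X (v i)‖ ^ 2 ≤ ‖LinearMap.trace ℂ E (X ∘ₗ U.toLinearEquiv.toLinearMap)‖ ^ 2 := by
  have hsym : (LinearMap.adjoint X ∘ₗ X).IsSymmetric := fun x y => by
    simp [LinearMap.adjoint_inner_left, LinearMap.adjoint_inner_right]
  let v := hsym.eigenvectorBasis rfl
  have hXX : ∀ i j, i ≠ j → inner ℂ (X (v i)) (X (v j)) = 0 := fun i j hij => by
    have h := hsym.apply_eigenvectorBasis rfl j
    rw [← LinearMap.adjoint_inner_right]
    change inner ℂ (v i) ((LinearMap.adjoint X ∘ₗ X) (hsym.eigenvectorBasis rfl j)) = 0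
    rw [h, inner_smul_right]
    simp [v, hsym.eigenvectorBasis rfl |>.inner_eq_zero hij]
  let w : Fin (finrank ℂ E) → E := fun i => ((‖X (v i)‖⁻¹ : ℝ) : ℂ) • X (v i)
  obtain ⟨u, hu⟩ := Orthonormal.exists_orthonormalBasis_extension_of_card_eq (𝕜 := ℂ) (E := E)
    (v := w) (s := {i | X (v i) ≠ 0}) (by simp) (by
      constructor
      · rintro ⟨i, hi⟩
        simp [w, norm_smul, inv_mul_cancel₀ (norm_ne_zero_iff.2 hi)]
      · rintro ⟨i, hi⟩ ⟨j, hj⟩ hij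
        have : i ≠ j := fun h => hij (by simp [h])
        simp [w, inner_smul_left, inner_smul_right, hXX i j this])
  have hXu : ∀ i, X (v i) = ((‖X (v i)‖ : ℝ) : ℂ) • u i := fun i => by
    by_cases h : X (v i) = 0
    · simp [h]
    · have h' : ((‖X (v i)‖ : ℝ) : ℂ) ≠ 0 := by simpa using h
      rw [hu i h]
      simp only [w, smul_smul, Complex.ofReal_inv]
      rw [mul_inv_cancel₀ h', one_smul]
  let U := u.equiv v (Equiv.refl _)
  refine ⟨U, v, ?_⟩
  have htr : LinearMap.trace ℂ E (X ∘ₗ U.toLinearEquiv.toLinearMap)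
      = ((∑ i, ‖X (v i)‖ : ℝ) : ℂ) := by
    rw [LinearMap.trace_eq_sum_inner _ u, Complex.ofReal_sum]
    refine Finset.sum_congr rfl fun i _ => ?_
    have : (X ∘ₗ U.toLinearEquiv.toLinearMap) (u i) = X (v i) := by simp [U]
    rw [this, hXu i, inner_smul_right, norm_smul]
    simp
  rw [htr, Complex.norm_real, Real.norm_eq_abs, sq_abs]
  exact Finset.sum_sq_le_sq_sum_of_nonneg fun i _ => norm_nonneg _

theorem trace_adjoint_comp_self {E : Type*} [NormedAddCommGroup E]
    [InnerProductSpace ℂ E] [FiniteDimensional ℂ E] (X : E →ₗ[ℂ] E) {κ : Type*} [Fintype κ]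
    (f : OrthonormalBasis κ ℂ E) :
    LinearMap.trace ℂ E (LinearMap.adjoint X ∘ₗ X) = ((∑ i, ‖X (f i)‖ ^ 2 : ℝ) : ℂ) := by
  rw [LinearMap.trace_eq_sum_inner _ f]
  simp [LinearMap.adjoint_inner_right, inner_self_eq_norm_sq_to_K]

/-- If `|⟨y, X y⟩|² ≤ ⟨y, A y⟩ ⟨y, B y⟩` for all `y`, then `‖X‖²` in the Hilbert–Schmidt norm is at
most `tr A * tr B`. With `U` unitary such that `tr (X U)` is the trace norm, this is the hypothesis
summed over an eigenbasis of `U`. -/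
theorem sum_norm_sq_le_of_numericalRange {E : Type*} [NormedAddCommGroup E]
    [InnerProductSpace ℂ E] [FiniteDimensional ℂ E] {X A B : E →ₗ[ℂ] E}
    (hA : ∀ y, 0 ≤ (inner ℂ y (A y)).re) (hB : ∀ y, 0 ≤ (inner ℂ y (B y)).re)
    (h : ∀ y, ‖inner ℂ y (X y)‖ ^ 2 ≤ (inner ℂ y (A y)).re * (inner ℂ y (B y)).re)
    {ι : Type*} [Fintype ι] (e : OrthonormalBasis ι ℂ E) :
    ∑ i, ‖X (e i)‖ ^ 2 ≤ (LinearMap.trace ℂ E A).re * (LinearMap.trace ℂ E B).re := by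
  obtain ⟨U, v, hUv⟩ := exists_linearIsometryEquiv_sum_norm_sq_le X
  obtain ⟨y, c, hc⟩ := exists_orthonormalBasis_eigenvectors U
  have hc1 : ∀ k, ‖c k‖ = 1 := fun k => by
    have := congrArg norm (hc k)
    simpa [norm_smul] using this.symm
  have hev : ∑ i, ‖X (e i)‖ ^ 2 = ∑ i, ‖X (v i)‖ ^ 2 := by
    have := (trace_adjoint_comp_self X e).symm.trans (trace_adjoint_comp_self X v)
    exact_mod_cast this
  have htr : ‖LinearMap.trace ℂ E (X ∘ₗ U.toLinearEquiv.toLinearMap)‖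
      ≤ ∑ k, ‖inner ℂ (y k) (X (y k))‖ := by
    rw [LinearMap.trace_eq_sum_inner _ y]
    refine (norm_sum_le _ _).trans_eq (Finset.sum_congr rfl fun k _ => ?_)
    have : (X ∘ₗ U.toLinearEquiv.toLinearMap) (y k) = c k • X (y k) := by simp [hc]
    rw [this, inner_smul_right, norm_mul, hc1, one_mul]
  have hre : ∀ Z : E →ₗ[ℂ] E, (LinearMap.trace ℂ E Z).re = ∑ k, (inner ℂ (y k) (Z (y k))).re :=
    fun Z => by rw [LinearMap.trace_eq_sum_inner _ y, Complex.re_sum]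
  rw [hev, hre, hre]
  refine hUv.trans ((pow_le_pow_left₀ (norm_nonneg _) htr 2).trans ?_)
  exact Finset.sum_sq_le_sum_mul_sum_of_sq_le_mul _ (fun k _ => hA _) (fun k _ => hB _)
    (fun k _ => h _)

theorem frobeniusNorm_sq {n : Type*} [Fintype n] (A : Matrix n n ℂ) :
    frobeniusNorm A ^ 2 = ∑ i, ∑ j, ‖A i j‖ ^ 2 :=
  Real.sq_sqrt (by positivity)

theorem isDensityMatrix_smul_vecMulVec {n : Type*} [Fintype n] {v : n → ℂ} (hv : v ≠ 0) :
    IsDensityMatrix (((∑ i, ‖v i‖ ^ 2)⁻¹ : ℝ) • vecMulVec v (star v)) := by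
  obtain ⟨i, hi⟩ := Function.ne_iff.1 hv
  have hi' : v i ≠ 0 := hi
  have hs : 0 < ∑ i, ‖v i‖ ^ 2 :=
    Finset.sum_pos' (fun _ _ => by positivity) ⟨i, Finset.mem_univ _, by positivity⟩
  refine ⟨(posSemidef_vecMulVec_self_star v).smul (by positivity), ?_⟩
  have : v ⬝ᵥ star v = ((∑ i, ‖v i‖ ^ 2 : ℝ) : ℂ) := by
    simp [dotProduct, Complex.mul_conj, Complex.normSq_eq_norm_sq]
  rw [trace_smul, trace_vecMulVec, this, Complex.real_smul, ← Complex.ofReal_mul,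
    inv_mul_cancel₀ hs.ne', Complex.ofReal_one]

/-- Witnesses are block positive: nonnegative on product vectors `x ⊗ y`. -/
theorem IsEntanglementWitness.re_dotProduct_nonneg {A B : Type*} [Fintype A] [Fintype B]
    {W : Matrix (A × B) (A × B) ℂ} (hW : IsEntanglementWitness W) (x : A → ℂ) (y : B → ℂ) :
    0 ≤ (star (fun p : A × B => x p.1 * y p.2) ⬝ᵥ
      W *ᵥ (fun p : A × B => x p.1 * y p.2)).re := by
  set z : A × B → ℂ := fun p => x p.1 * y p.2 with hz
  rcases eq_or_ne x 0 with rfl | hx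
  · have : z = 0 := by ext p; simp [hz]
    simp [this]
  rcases eq_or_ne y 0 with rfl | hy
  · have : z = 0 := by ext p; simp [hz]
    simp [this]
  have h := hW.2 _ (subset_convexHull ℝ _
    ⟨_, _, isDensityMatrix_smul_vecMulVec hx, isDensityMatrix_smul_vecMulVec hy, rfl⟩)
  have hk : vecMulVec x (star x) ⊗ₖ vecMulVec y (star y) = vecMulVec z (star z) := by
    ext p q
    simp [kroneckerMap_apply, vecMulVec_apply, hz]
    ring
  rw [smul_kronecker, kronecker_smul, smul_smul, hk, smul_mul, trace_smul, vecMulVec_mul,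
    trace_vecMulVec, dotProduct_comm, ← dotProduct_mulVec, Complex.smul_re, smul_eq_mul] at h
  have h1 : 0 < (∑ i, ‖x i‖ ^ 2)⁻¹ * (∑ i, ‖y i‖ ^ 2)⁻¹ := by
    obtain ⟨i, hi⟩ := Function.ne_iff.1 hx
    obtain ⟨j, hj⟩ := Function.ne_iff.1 hy
    have hi' : x i ≠ 0 := hi
    have hj' : y j ≠ 0 := hj
    have hs : 0 < ∑ i, ‖x i‖ ^ 2 :=
      Finset.sum_pos' (fun _ _ => by positivity) ⟨i, Finset.mem_univ _, by positivity⟩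
    have ht : 0 < ∑ i, ‖y i‖ ^ 2 :=
      Finset.sum_pos' (fun _ _ => by positivity) ⟨j, Finset.mem_univ _, by positivity⟩
    positivity
  exact nonneg_of_mul_nonneg_right h h1

/-- Block positivity in terms of the blocks `W_{ij}` of `W`: the matrix `(⟨y, W_{ij} y⟩)_{ij}` is
positive semidefinite for every `y`. -/
theorem IsEntanglementWitness.posSemidef_compression {A B : Type*} [Fintype A] [Fintype B]
    {W : Matrix (A × B) (A × B) ℂ} (hW : IsEntanglementWitness W) (y : B → ℂ) :
    (Matrix.of fun i j : A =>
      star y ⬝ᵥ W.submatrix (Prod.mk i) (Prod.mk j) *ᵥ y).PosSemidef := by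
  have hherm : (Matrix.of fun i j : A =>
      star y ⬝ᵥ W.submatrix (Prod.mk i) (Prod.mk j) *ᵥ y).IsHermitian := by
    ext i j
    simp only [conjTranspose_apply, of_apply, dotProduct, mulVec, star_sum, star_mul',
      Pi.star_apply, star_star, submatrix_apply, Finset.mul_sum]
    rw [Finset.sum_comm]
    refine Finset.sum_congr rfl fun a _ => Finset.sum_congr rfl fun b _ => ?_
    rw [← hW.1.apply (i, a) (j, b)]
    ring
  refine PosSemidef.of_dotProduct_mulVec_nonneg hherm fun x => ?_
  rw [Complex.nonneg_iff]
  refine ⟨?_, (hherm.im_star_dotProduct_mulVec_self x).symm⟩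
  convert hW.re_dotProduct_nonneg x y using 2
  simp only [dotProduct, mulVec, of_apply, Pi.star_apply, submatrix_apply, Fintype.sum_prod_type,
    Finset.mul_sum, Finset.sum_mul, star_mul']
  refine Finset.sum_congr rfl fun i _ => ?_
  rw [Finset.sum_comm]
  refine Finset.sum_congr rfl fun a _ => Finset.sum_congr rfl fun j _ =>
    Finset.sum_congr rfl fun b _ => ?_
  ring

/-- Nonnegativity of the principal `2 × 2` minors. -/
theorem posSemidef_norm_sq_le {n : Type*} [Fintype n] {M : Matrix n n ℂ} (hM : M.PosSemidef)
    (i j : n) : ‖M i j‖ ^ 2 ≤ (M i i).re * (M j j).re := by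
  have h := (hM.submatrix ![i, j]).det_nonneg
  rw [det_fin_two, Complex.nonneg_iff] at h
  have h1 := h.1
  have hii := (Complex.nonneg_iff.1 (hM.diag_nonneg (i := i))).2
  simp only [submatrix_apply, cons_val_zero, cons_val_one, Complex.sub_re, Complex.mul_re] at h1
  have hji : M j i = star (M i j) := (hM.1.apply j i).symm
  rw [hji] at h1
  have : ‖M i j‖ ^ 2 = (M i j).re * (M i j).re + (M i j).im * (M i j).im := by
    rw [← Complex.normSq_eq_norm_sq, Complex.normSq_apply]
  simp only [Complex.star_def, Complex.conj_re, Complex.conj_im, ← hii] at h1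
  linarith

/-- The blocks of a witness satisfy `‖W_{ij}‖_F² ≤ tr W_{ii} * tr W_{jj}`, and these bounds add up
to `(tr W)²`. -/
theorem IsEntanglementWitness.frobeniusNorm_sq_le {A B : Type*} [Fintype A] [Fintype B]
    {W : Matrix (A × B) (A × B) ℂ} (hW : IsEntanglementWitness W) :
    frobeniusNorm W ^ 2 ≤ W.trace.re ^ 2 := by
  classical
  let X : A → A → (EuclideanSpace ℂ B →ₗ[ℂ] EuclideanSpace ℂ B) := fun i j =>
    toEuclideanLin (W.submatrix (Prod.mk i) (Prod.mk j))
  have hX : ∀ i j y, inner ℂ y (X i j y) =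
      star y.ofLp ⬝ᵥ W.submatrix (Prod.mk i) (Prod.mk j) *ᵥ y.ofLp := fun i j y => by
    simp [X, EuclideanSpace.inner_eq_star_dotProduct, dotProduct_comm]
  have hdiag : ∀ i y, 0 ≤ (inner ℂ y (X i i y)).re := fun i y => by
    rw [hX]
    exact (Complex.nonneg_iff.1 ((hW.posSemidef_compression y.ofLp).diag_nonneg (i := i))).1
  have htr : ∀ i, (LinearMap.trace ℂ _ (X i i)).re = ∑ b, (W (i, b) (i, b)).re := fun i => by
    rw [LinearMap.trace_eq_sum_inner _ (EuclideanSpace.basisFun B ℂ)]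
    simp only [hX, EuclideanSpace.basisFun_apply, Complex.re_sum]
    simp
  have key : ∀ i j, ∑ b, ∑ a, ‖W (i, a) (j, b)‖ ^ 2 ≤
      (∑ b, (W (i, b) (i, b)).re) * ∑ b, (W (j, b) (j, b)).re := fun i j => by
    rw [← htr, ← htr]
    refine le_trans (le_of_eq ?_) (sum_norm_sq_le_of_numericalRange (X := X i j)
      (hdiag i) (hdiag j) (fun y => ?_) (EuclideanSpace.basisFun B ℂ))
    · simp [X, EuclideanSpace.norm_sq_eq]
    · simp only [hX]
      exact posSemidef_norm_sq_le (hW.posSemidef_compression y.ofLp) i j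
  calc frobeniusNorm W ^ 2 = ∑ i, ∑ j, ∑ b, ∑ a, ‖W (i, a) (j, b)‖ ^ 2 := by
        rw [frobeniusNorm_sq]
        simp only [Fintype.sum_prod_type]
        refine Finset.sum_congr rfl fun i _ => ?_
        rw [Finset.sum_comm]
        exact Finset.sum_congr rfl fun j _ => Finset.sum_comm
    _ ≤ ∑ i, ∑ j, (∑ b, (W (i, b) (i, b)).re) * ∑ b, (W (j, b) (j, b)).re :=
        Finset.sum_le_sum fun i _ => Finset.sum_le_sum fun j _ => key i j
    _ = W.trace.re ^ 2 := by
        rw [← Finset.sum_mul_sum, ← sq, trace, Complex.re_sum, Fintype.sum_prod_type]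
        rfl

theorem IsEntanglementWitness.trace_re_nonneg {A B : Type*} [Fintype A] [Fintype B]
    {W : Matrix (A × B) (A × B) ℂ} (hW : IsEntanglementWitness W) : 0 ≤ W.trace.re := by
  classical
  rw [trace, Complex.re_sum]
  refine Finset.sum_nonneg fun p _ => ?_
  have h := (Complex.nonneg_iff.1
    ((hW.posSemidef_compression (Pi.single p.2 1)).diag_nonneg (i := p.1))).1
  simpa using h

theorem IsEntanglementWitness.frobeniusNorm_le_trace {A B : Type*} [Fintype A] [Fintype B]
    {W : Matrix (A × B) (A × B) ℂ} (hW : IsEntanglementWitness W) :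
    frobeniusNorm W ≤ W.trace.re :=
  (le_abs_self _).trans (abs_le_of_sq_le_sq hW.frobeniusNorm_sq_le hW.trace_re_nonneg)

/-! ### Quadratic forms at a uniformly distributed unit vector -/

/-- Integration in polar coordinates over a cone `C`: a radial function has an integral
proportional to the surface measure of the part of the unit sphere in `C`. -/
theorem setLIntegral_cone_norm {E : Type*} [NormedAddCommGroup E] [NormedSpace ℝ E]
    [MeasurableSpace E] [BorelSpace E] [FiniteDimensional ℝ E] [Nontrivial E]
    (μ : Measure E) [μ.IsAddHaarMeasure] {C : Set E} (hCm : MeasurableSet C)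
    (hC : ∀ (r : ℝ) (x : E), 0 < r → (r • x ∈ C ↔ x ∈ C)) {g : ℝ → ENNReal} (hg : Measurable g) :
    ∫⁻ x in C, g ‖x‖ ∂μ = μ.toSphere {φ | φ.1 ∈ C} *
      ∫⁻ r : Set.Ioi (0 : ℝ), g r ∂Measure.volumeIoiPow (Module.finrank ℝ E - 1) := by
  have hSm : MeasurableSet {φ : Metric.sphere (0 : E) 1 | φ.1 ∈ C} := measurable_subtype_coe hCm
  let G : Metric.sphere (0 : E) 1 × Set.Ioi (0 : ℝ) → ENNReal := fun z =>
    {φ : Metric.sphere (0 : E) 1 | φ.1 ∈ C}.indicator (fun _ => 1) z.1 * g z.2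
  have hG := μ.measurePreserving_homeomorphUnitSphereProd.lintegral_comp_emb
    (Homeomorph.measurableEmbedding _) G
  have hprod := lintegral_prod_mul (μ := μ.toSphere)
    (ν := Measure.volumeIoiPow (Module.finrank ℝ E - 1))
    (f := {φ : Metric.sphere (0 : E) 1 | φ.1 ∈ C}.indicator fun _ => 1)
    (g := fun r : Set.Ioi (0 : ℝ) => g r) (measurable_const.indicator hSm).aemeasurable
    (hg.comp measurable_subtype_coe).aemeasurable
  rw [lintegral_indicator_const hSm, one_mul] at hprod
  rw [← lintegral_indicator hCm, ← hprod]
  refine Eq.trans ?_ hG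
  conv_lhs => rw [← restrict_compl_singleton (μ := μ) 0,
    ← lintegral_subtype_comap (measurableSet_singleton _).compl]
  refine lintegral_congr fun x => ?_
  have hmem : ‖x.1‖⁻¹ • x.1 ∈ C ↔ x.1 ∈ C := hC _ _ (inv_pos.2 (norm_pos_iff.2 x.2))
  by_cases h : x.1 ∈ C <;> simp [G, Set.indicator, h, hmem]

/-- Gaussian integrals with different variances, relative to the standard one. In this form the
normalization of the volume on `EuclideanSpace ℂ ι` is irrelevant. -/
theorem integral_exp_neg_sum_mul_norm_sq {ι : Type*} [Fintype ι] {b : ι → ℝ}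
    (hb : ∀ i, 0 < b i) :
    ∫ x : EuclideanSpace ℂ ι, Real.exp (-∑ i, b i * ‖x i‖ ^ 2) =
      (∏ i, (b i)⁻¹) * ∫ x : EuclideanSpace ℂ ι, Real.exp (-‖x‖ ^ 2) := by
  let e : EuclideanSpace ℂ ι ≃L[ℝ] (ι → ℂ) := PiLp.continuousLinearEquiv 2 ℝ fun _ : ι => ℂ
  have : (Measure.map e volume).IsAddHaarMeasure := e.isAddHaarMeasure_map _
  have hν := Measure.isAddLeftInvariant_eq_smul (Measure.map e volume) (volume : Measure (ι → ℂ))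
  set κ := Measure.addHaarScalarFactor (Measure.map e volume) (volume : Measure (ι → ℂ))
  have key : ∀ {b : ι → ℝ}, (∀ i, 0 < b i) →
      ∫ x : EuclideanSpace ℂ ι, Real.exp (-∑ i, b i * ‖x i‖ ^ 2) =
        (κ : ℝ) * ∏ i, (Real.pi / b i) := fun {b} hb => by
    calc ∫ x : EuclideanSpace ℂ ι, Real.exp (-∑ i, b i * ‖x i‖ ^ 2)
        = ∫ y, Real.exp (-∑ i, b i * ‖y i‖ ^ 2) ∂(Measure.map e volume) :=
          (e.toHomeomorph.measurableEmbedding.integral_map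
            (fun y : ι → ℂ => Real.exp (-∑ i, b i * ‖y i‖ ^ 2))).symm
      _ = κ * ∫ y : ι → ℂ, ∏ i, Real.exp (-b i * ‖y i‖ ^ 2) := by
          rw [hν, integral_smul_nnreal_measure]
          simp only [← Real.exp_sum, ← Finset.sum_neg_distrib, neg_mul]
          rfl
      _ = _ := by
          rw [integral_fintype_prod_volume_eq_prod (fun i (z : ℂ) => Real.exp (-b i * ‖z‖ ^ 2))]
          congr 1
          refine Finset.prod_congr rfl fun i _ => ?_
          rw [GaussianFourier.integral_rexp_neg_mul_sq_norm (hb i)]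
          simp
  have h1 := key (b := fun _ => 1) (fun _ => one_pos)
  simp only [one_mul, ← EuclideanSpace.norm_sq_eq] at h1
  rw [key hb, h1]
  simp only [div_eq_mul_inv, Finset.prod_mul_distrib]
  simp
  ring

theorem toEuclideanLin_eigenvectorBasis {ι : Type*} [Fintype ι] [DecidableEq ι]
    {B : Matrix ι ι ℂ} (hB : B.IsHermitian) (p : ι) :
    toEuclideanLin B (hB.eigenvectorBasis p) =
      (hB.eigenvalues p : ℂ) • hB.eigenvectorBasis p := by
  ext i
  simpa using congrFun (hB.mulVec_eigenvectorBasis p) i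

theorem re_dotProduct_mulVec_eq_sum_eigenvalues {ι : Type*} [Fintype ι] [DecidableEq ι]
    {B : Matrix ι ι ℂ} (hB : B.IsHermitian) (x : EuclideanSpace ℂ ι) :
    (star x.ofLp ⬝ᵥ B *ᵥ x.ofLp).re =
      ∑ p, hB.eigenvalues p * ‖hB.eigenvectorBasis.repr x p‖ ^ 2 := by
  have h1 : star x.ofLp ⬝ᵥ B *ᵥ x.ofLp = inner ℂ x (toEuclideanLin B x) := by
    simp [EuclideanSpace.inner_eq_star_dotProduct, dotProduct_comm]
  have h2 : ∀ p, inner ℂ (hB.eigenvectorBasis p) (toEuclideanLin B x) =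
      hB.eigenvalues p * hB.eigenvectorBasis.repr x p := fun p => by
    have := isSymmetric_toEuclideanLin_iff.2 hB (hB.eigenvectorBasis p) x
    rw [← this]
    rw [toEuclideanLin_eigenvectorBasis, inner_smul_left, OrthonormalBasis.repr_apply_apply]
    simp
  rw [h1, ← OrthonormalBasis.sum_inner_mul_inner hB.eigenvectorBasis, Complex.re_sum]
  refine Finset.sum_congr rfl fun p _ => ?_
  rw [h2, ← inner_conj_symm, OrthonormalBasis.repr_apply_apply, mul_left_comm,
    mul_comm ((starRingEnd ℂ) _), Complex.mul_conj, Complex.normSq_eq_norm_sq]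
  norm_cast

theorem integral_exp_neg_quadratic {ι : Type*} [Fintype ι] [DecidableEq ι]
    {B : Matrix ι ι ℂ} (hB : B.IsHermitian) {t : ℝ} (ht : ∀ p, 0 < 1 + t * hB.eigenvalues p) :
    ∫ x : EuclideanSpace ℂ ι, Real.exp (-‖x‖ ^ 2 - t * (star x.ofLp ⬝ᵥ B *ᵥ x.ofLp).re) =
      (∏ p, (1 + t * hB.eigenvalues p)⁻¹) * ∫ x : EuclideanSpace ℂ ι, Real.exp (-‖x‖ ^ 2) := by
  rw [← integral_exp_neg_sum_mul_norm_sq ht]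
  let e : EuclideanSpace ℂ ι ≃ₗᵢ[ℝ] EuclideanSpace ℂ ι :=
    { hB.eigenvectorBasis.repr.toLinearEquiv.restrictScalars ℝ with
      norm_map' := hB.eigenvectorBasis.repr.norm_map }
  refine Eq.trans ?_ (e.measurePreserving.integral_comp e.toHomeomorph.measurableEmbedding
    fun x => Real.exp (-∑ p, (1 + t * hB.eigenvalues p) * ‖x p‖ ^ 2))
  congr 1 with x
  have h1 : ‖x‖ ^ 2 = ∑ p, ‖hB.eigenvectorBasis.repr x p‖ ^ 2 := by
    rw [← EuclideanSpace.norm_sq_eq, LinearIsometryEquiv.norm_map]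
  rw [re_dotProduct_mulVec_eq_sum_eigenvalues hB, h1, Finset.mul_sum, ← Finset.sum_neg_distrib,
    ← Finset.sum_sub_distrib, ← Finset.sum_neg_distrib]
  congr 1
  refine Finset.sum_congr rfl fun p _ => ?_
  change _ = -((1 + t * hB.eigenvalues p) * ‖hB.eigenvectorBasis.repr x p‖ ^ 2)
  ring

/-- The Chernoff bound for a quadratic form `q` at a uniform point of the unit sphere. The sign of
`q` is constant on rays, so the point may be replaced by a Gaussian vector, and
`1_{q < 0} ≤ exp (-t q)`. -/
theorem uniformPureState_quadratic_neg_le {ι : Type*} [Fintype ι] [DecidableEq ι] [Nonempty ι]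
    {B : Matrix ι ι ℂ} (hB : B.IsHermitian) {t : ℝ} (ht0 : 0 ≤ t)
    (ht : ∀ p, 0 < 1 + t * hB.eigenvalues p) :
    (uniformPureState ι).real {φ | (star φ.1.ofLp ⬝ᵥ B *ᵥ φ.1.ofLp).re < 0} ≤
      ∏ p, (1 + t * hB.eigenvalues p)⁻¹ := by
  set C : Set (EuclideanSpace ℂ ι) := {x | (star x.ofLp ⬝ᵥ B *ᵥ x.ofLp).re < 0} with hCdef
  have hcont : Continuous fun x : EuclideanSpace ℂ ι => (star x.ofLp ⬝ᵥ B *ᵥ x.ofLp).re := by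
    simp only [dotProduct, mulVec, Pi.star_apply]
    fun_prop
  have hCm : MeasurableSet C := (isOpen_Iio.preimage hcont).measurableSet
  have hC : ∀ (r : ℝ) (x : EuclideanSpace ℂ ι), 0 < r → (r • x ∈ C ↔ x ∈ C) := fun r x hr => by
    have : (star (r • x).ofLp ⬝ᵥ B *ᵥ (r • x).ofLp).re =
        r * (r * (star x.ofLp ⬝ᵥ B *ᵥ x.ofLp).re) := by
      rw [WithLp.ofLp_smul, star_smul, mulVec_smul, smul_dotProduct, dotProduct_smul]
      simp
    simp only [hCdef, Set.mem_ofPred_eq, this]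
    constructor
    · intro h; by_contra! h'; exact absurd h (by push Not; positivity)
    · intro h; exact mul_neg_of_pos_of_neg hr (mul_neg_of_pos_of_neg hr h)
  let g : ℝ → ENNReal := fun r => ENNReal.ofReal (Real.exp (-r ^ 2))
  have hg : Measurable g := by fun_prop
  have h1 := setLIntegral_cone_norm (volume : Measure (EuclideanSpace ℂ ι)) hCm hC hg
  have h2 := setLIntegral_cone_norm (volume : Measure (EuclideanSpace ℂ ι)) MeasurableSet.univ
    (fun _ _ _ => by simp) hg
  set I := ∫⁻ r : Set.Ioi (0 : ℝ), g r
    ∂Measure.volumeIoiPow (Module.finrank ℝ (EuclideanSpace ℂ ι) - 1)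
  set τ := (volume : Measure (EuclideanSpace ℂ ι)).toSphere with hτ
  simp only [Set.mem_univ, Set.ofPred_true, Measure.restrict_univ] at h2
  set J := ∫ x : EuclideanSpace ℂ ι, Real.exp (-‖x‖ ^ 2) with hJ
  have hJpos : 0 < J := by
    have h := GaussianFourier.integral_rexp_neg_mul_sq_norm (V := EuclideanSpace ℂ ι) one_pos
    simp only [neg_mul, one_mul] at h
    rw [hJ, h]
    positivity
  -- A nonzero Bochner integral certifies integrability, here and for `hqint`.
  have hJint : Integrable fun x : EuclideanSpace ℂ ι => Real.exp (-‖x‖ ^ 2) :=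
    not_imp_comm.1 integral_undef hJpos.ne'
  have hgJ : ∫⁻ x : EuclideanSpace ℂ ι, g ‖x‖ = ENNReal.ofReal J :=
    (ofReal_integral_eq_lintegral_ofReal hJint
      (Filter.Eventually.of_forall fun _ => (Real.exp_pos _).le)).symm
  have hprod : 0 < ∏ p, (1 + t * hB.eigenvalues p)⁻¹ :=
    Finset.prod_pos fun p _ => inv_pos.2 (ht p)
  have hq := integral_exp_neg_quadratic hB ht
  have hqint : Integrable fun x : EuclideanSpace ℂ ι =>
      Real.exp (-‖x‖ ^ 2 - t * (star x.ofLp ⬝ᵥ B *ᵥ x.ofLp).re) :=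
    not_imp_comm.1 integral_undef (by rw [hq]; positivity)
  have hle : ∫⁻ x in C, g ‖x‖ ≤ ENNReal.ofReal ((∏ p, (1 + t * hB.eigenvalues p)⁻¹) * J) := by
    rw [← hq, ofReal_integral_eq_lintegral_ofReal hqint
      (Filter.Eventually.of_forall fun _ => (Real.exp_pos _).le)]
    refine (setLIntegral_mono' hCm fun x hx => ?_).trans (setLIntegral_le_lintegral C _)
    refine ENNReal.ofReal_le_ofReal (Real.exp_le_exp.2 ?_)
    have : (star x.ofLp ⬝ᵥ B *ᵥ x.ofLp).re < 0 := hx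
    nlinarith
  have hτ0 : τ Set.univ ≠ 0 := by
    rw [Measure.measure_univ_ne_zero]
    exact Measure.toSphere_ne_zero _
  have hτtop : τ Set.univ ≠ ⊤ := measure_ne_top _ _
  have hP : uniformPureState ι {φ | φ.1 ∈ C} * ENNReal.ofReal J = ∫⁻ x in C, g ‖x‖ := by
    rw [← hgJ, h2, h1, uniformPureState, Measure.smul_apply, smul_eq_mul, ← hτ]
    calc (τ Set.univ)⁻¹ * τ {φ | φ.1 ∈ C} * (τ Set.univ * I)
        = ((τ Set.univ)⁻¹ * τ Set.univ) * (τ {φ | φ.1 ∈ C} * I) := by ring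
      _ = _ := by rw [ENNReal.inv_mul_cancel hτ0 hτtop, one_mul]
  have h3 := hP.trans_le hle
  rw [ENNReal.ofReal_mul hprod.le] at h3
  have h4 : uniformPureState ι {φ | φ.1 ∈ C} ≤
      ENNReal.ofReal (∏ p, (1 + t * hB.eigenvalues p)⁻¹) :=
    (ENNReal.mul_le_mul_iff_left (ENNReal.ofReal_pos.2 hJpos).ne' ENNReal.ofReal_ne_top).1 h3
  exact ENNReal.toReal_le_of_le_ofReal hprod.le h4

/-- A second-order lower bound for the logarithm. For `u ≤ 0` it is
`log y ≤ sinh (log y) = (y - y⁻¹) / 2` at `y = (1 + u)⁻¹`. -/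
theorem sub_sq_div_le_log_one_add {s u : ℝ} (hs0 : 0 ≤ s) (hs1 : s < 1) (hu : -s ≤ u) :
    u - u ^ 2 / (2 * (1 - s)) ≤ Real.log (1 + u) := by
  rcases le_total 0 u with h | h
  · refine le_trans ?_ (Real.le_log_one_add_of_nonneg h)
    have h1 : u ^ 2 / 2 ≤ u ^ 2 / (2 * (1 - s)) :=
      div_le_div_of_nonneg_left (sq_nonneg u) (by linarith) (by linarith)
    have h2 : 2 * u / (u + 2) - (u - u ^ 2 / 2) = u ^ 3 / (2 * (u + 2)) := by
      field_simp
      ring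
    have h3 : 0 ≤ u ^ 3 / (2 * (u + 2)) := by positivity
    linarith
  · have hpos : 0 < 1 + u := by linarith
    have h1 : -Real.log (1 + u) ≤ Real.sinh (-Real.log (1 + u)) :=
      Real.self_le_sinh_iff.2 (by
        have := Real.log_nonpos hpos.le (by linarith)
        linarith)
    rw [Real.sinh_neg, Real.sinh_log hpos] at h1
    have h2 : -((1 + u - (1 + u)⁻¹) / 2) = -u + u ^ 2 / (2 * (1 + u)) := by
      field_simp
      ring
    have h3 : u ^ 2 / (2 * (1 + u)) ≤ u ^ 2 / (2 * (1 - s)) :=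
      div_le_div_of_nonneg_left (sq_nonneg u) (by linarith) (by linarith)
    linarith

theorem prod_inv_one_add_le {ι : Type*} [Fintype ι] {μ : ι → ℝ} (hμ : ∀ i, |μ i| ≤ 1)
    {t : ℝ} (ht0 : 0 ≤ t) (ht1 : t < 1) :
    ∏ i, (1 + t * μ i)⁻¹ ≤
      Real.exp (-(t * ∑ i, μ i) + t ^ 2 / (2 * (1 - t)) * ∑ i, μ i ^ 2) := by
  rw [Finset.mul_sum, Finset.mul_sum, ← Finset.sum_neg_distrib, ← Finset.sum_add_distrib,
    Real.exp_sum]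
  have hlow : ∀ i, -t ≤ t * μ i := fun i => by nlinarith [(abs_le.1 (hμ i)).1]
  refine Finset.prod_le_prod (fun i _ => inv_nonneg.2 (by linarith [hlow i])) fun i _ => ?_
  have hp : 0 < 1 + t * μ i := by linarith [hlow i]
  rw [← Real.exp_log (inv_pos.2 hp), Real.log_inv]
  refine Real.exp_le_exp.2 ?_
  have h := sub_sq_div_le_log_one_add ht0 ht1 (hlow i)
  have h2 : (t * μ i) ^ 2 / (2 * (1 - t)) = t ^ 2 / (2 * (1 - t)) * μ i ^ 2 := by ring
  linarith

/-! ### Expectations in a random reduced state -/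

theorem isProbabilityMeasure_uniformPureState (ι : Type*) [Fintype ι] [Nonempty ι] :
    IsProbabilityMeasure (uniformPureState ι) := by
  constructor
  rw [uniformPureState, Measure.smul_apply, smul_eq_mul]
  refine ENNReal.inv_mul_cancel ?_ (measure_ne_top _ _)
  rw [Measure.measure_univ_ne_zero]
  exact Measure.toSphere_ne_zero _

theorem trace_partialTrace_pureState_mul {n r : Type*} [Fintype n] [Fintype r] [DecidableEq r]
    (x : EuclideanSpace ℂ (n × r)) (A : Matrix n n ℂ) :
    (partialTrace (pureState x) * A).trace =
      star x.ofLp ⬝ᵥ (A ⊗ₖ (1 : Matrix r r ℂ)) *ᵥ x.ofLp := by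
  simp only [trace, diag_apply, mul_apply, partialTrace, pureState, of_apply, dotProduct, mulVec,
    kroneckerMap_apply, Fintype.sum_prod_type, Pi.star_apply, one_apply, Finset.sum_mul,
    Finset.mul_sum, mul_ite, mul_one, mul_zero, ite_mul, zero_mul, Finset.sum_ite_eq,
    Finset.mem_univ, if_true]
  rw [Finset.sum_comm]
  refine Finset.sum_congr rfl fun j _ => ?_
  rw [Finset.sum_comm]
  refine Finset.sum_congr rfl fun a _ => Finset.sum_congr rfl fun i _ => ?_
  ring

theorem trace_partialTrace_pureState {n r : Type*} [Fintype n] [Fintype r]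
    (x : EuclideanSpace ℂ (n × r)) :
    (partialTrace (pureState x)).trace = ((‖x‖ ^ 2 : ℝ) : ℂ) := by
  simp [trace, partialTrace, pureState, EuclideanSpace.norm_sq_eq, Fintype.sum_prod_type,
    Complex.mul_conj, Complex.normSq_eq_norm_sq]

theorem norm_trace_mul_le {n : Type*} [Fintype n] (M A : Matrix n n ℂ) :
    ‖(M * A).trace‖ ≤ frobeniusNorm M * frobeniusNorm A := by
  have h1 : ‖(M * A).trace‖ ≤ ∑ p : n × n, ‖M p.1 p.2‖ * ‖A p.2 p.1‖ := by
    rw [Fintype.sum_prod_type, trace]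
    refine (norm_sum_le _ _).trans (Finset.sum_le_sum fun i _ => ?_)
    rw [diag_apply, mul_apply]
    refine (norm_sum_le _ _).trans (Finset.sum_le_sum fun j _ => (norm_mul _ _).le)
  refine h1.trans ((Real.sum_mul_le_sqrt_mul_sqrt _ _ _).trans (le_of_eq ?_))
  rw [frobeniusNorm, frobeniusNorm, Fintype.sum_prod_type, Fintype.sum_prod_type_right]

theorem frobeniusNorm_partialTrace_pureState_le {n r : Type*} [Fintype n] [Fintype r]
    (x : EuclideanSpace ℂ (n × r)) : frobeniusNorm (partialTrace (pureState x)) ≤ ‖x‖ ^ 2 := by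
  refine Real.sqrt_le_iff.2 ⟨by positivity, ?_⟩
  have h : ∀ i j, ‖partialTrace (pureState x) i j‖ ^ 2 ≤
      (∑ a, ‖x (i, a)‖ ^ 2) * ∑ a, ‖x (j, a)‖ ^ 2 := fun i j => by
    refine (pow_le_pow_left₀ (norm_nonneg _) (norm_sum_le _ _) 2).trans ?_
    simp only [pureState, of_apply, norm_mul, norm_star]
    exact Finset.sum_mul_sq_le_sq_mul_sq _ _ _
  refine (Finset.sum_le_sum fun i _ => Finset.sum_le_sum fun j _ => h i j).trans (le_of_eq ?_)
  rw [← Finset.sum_mul_sum, EuclideanSpace.norm_sq_eq, Fintype.sum_prod_type]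
  ring

theorem norm_trace_partialTrace_pureState_mul_le {n r : Type*} [Fintype n] [Fintype r]
    (x : EuclideanSpace ℂ (n × r)) (A : Matrix n n ℂ) :
    ‖(partialTrace (pureState x) * A).trace‖ ≤ ‖x‖ ^ 2 * frobeniusNorm A :=
  (norm_trace_mul_le _ _).trans
    (mul_le_mul_of_nonneg_right (frobeniusNorm_partialTrace_pureState_le x) (Real.sqrt_nonneg _))

theorem sum_sq_eigenvalues_eq_frobeniusNorm_sq {ι : Type*} [Fintype ι] [DecidableEq ι]
    {B : Matrix ι ι ℂ} (hB : B.IsHermitian) :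
    ∑ p, hB.eigenvalues p ^ 2 = frobeniusNorm B ^ 2 := by
  have h := (trace_adjoint_comp_self (toEuclideanLin B) hB.eigenvectorBasis).symm.trans
    (trace_adjoint_comp_self (toEuclideanLin B) (EuclideanSpace.basisFun ι ℂ))
  rw [Complex.ofReal_inj] at h
  simp only [toEuclideanLin_eigenvectorBasis, norm_smul, OrthonormalBasis.norm_eq_one, mul_one,
    Complex.norm_real, Real.norm_eq_abs, sq_abs] at h
  rw [h, frobeniusNorm_sq, Finset.sum_comm]
  simp [EuclideanSpace.norm_sq_eq]

/-- The detection bound for a single observable `A`: it is the Chernoff bound for `A ⊗ 1`, whose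
eigenvalues lie in `[-1, 1]`, have sum `k tr A`, and have square sum at most `k`. -/
theorem uniformPureState_expectation_neg_le {n : Type*} [Fintype n] [Nonempty n]
    {k : ℕ} (hk : 0 < k) {A : Matrix n n ℂ} (hA : A.IsHermitian) (hF : frobeniusNorm A ≤ 1)
    {a : ℝ} (ha : 0 ≤ a) (hta : a ≤ A.trace.re) :
    (uniformPureState (n × Fin k)).real {φ | (partialTrace (pureState φ.1) * A).trace.re < 0} ≤
      Real.exp (-((√(1 + a) - 1) ^ 2 * k)) := by
  classical
  have : Nonempty (Fin k) := ⟨⟨0, hk⟩⟩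
  set B : Matrix (n × Fin k) (n × Fin k) ℂ := A ⊗ₖ 1 with hBdef
  have hB : B.IsHermitian := by
    rw [IsHermitian, hBdef, conjTranspose_kronecker, hA.eq, conjTranspose_one]
  have hμ : ∀ p, |hB.eigenvalues p| ≤ 1 := fun p => by
    rw [hB.eigenvalues_eq p]
    have h1 := trace_partialTrace_pureState_mul (hB.eigenvectorBasis p) A
    have h2 := norm_trace_partialTrace_pureState_mul_le (hB.eigenvectorBasis p) A
    rw [OrthonormalBasis.norm_eq_one, one_pow, one_mul, h1] at h2
    exact (Complex.abs_re_le_norm _).trans (h2.trans hF)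
  have hsum : ∑ p, hB.eigenvalues p = A.trace.re * k := by
    have h1 := congrArg Complex.re hB.trace_eq_sum_eigenvalues
    have h2 : B.trace = A.trace * k := by
      rw [hBdef, trace_kronecker, trace_one, Fintype.card_fin]
    rw [h2] at h1
    simpa using h1.symm
  have hsq : ∑ p, hB.eigenvalues p ^ 2 ≤ k := by
    rw [sum_sq_eigenvalues_eq_frobeniusNorm_sq hB, frobeniusNorm_sq]
    have h1 : ∑ p, ∑ q, ‖B p q‖ ^ 2 = k * frobeniusNorm A ^ 2 := by
      rw [frobeniusNorm_sq]
      simp only [hBdef, kroneckerMap_apply, one_apply, Fintype.sum_prod_type, mul_ite, mul_one,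
        mul_zero]
      have : ∀ (i j : n) (c e : Fin k), ‖(if c = e then A i j else 0)‖ ^ 2 =
          if c = e then ‖A i j‖ ^ 2 else 0 := fun i j c e => by split_ifs <;> simp
      simp only [this, Finset.sum_ite_eq, Finset.mem_univ, if_true]
      simp [Finset.mul_sum]
    rw [h1]
    have h2 : frobeniusNorm A ^ 2 ≤ 1 := pow_le_one₀ (Real.sqrt_nonneg _) hF
    have h3 : (0 : ℝ) ≤ k := Nat.cast_nonneg _
    nlinarith
  set s := √(1 + a) with hs
  have hs1 : 1 ≤ s := Real.one_le_sqrt.2 (by linarith)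
  have hs2 : s ^ 2 = 1 + a := Real.sq_sqrt (by linarith)
  have hspos : 0 < s := by linarith
  -- At this `t` the exponent is `-(s - 1)² (2s + 1) / (2s) * k`, slightly better than needed.
  set t := 1 - s⁻¹ with ht
  have ht0 : 0 ≤ t := by
    have := inv_le_one_of_one_le₀ hs1
    linarith
  have ht1 : t < 1 := by
    have := inv_pos.2 hspos
    linarith
  have h1 := uniformPureState_quadratic_neg_le hB ht0
    (fun p => by nlinarith [(abs_le.1 (hμ p)).1])
  have h2 := prod_inv_one_add_le hμ ht0 ht1
  simp only [← trace_partialTrace_pureState_mul, hBdef] at h1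
  refine h1.trans (h2.trans (Real.exp_le_exp.2 ?_))
  have hk0 : (0 : ℝ) ≤ k := Nat.cast_nonneg _
  have hc : 0 ≤ t ^ 2 / (2 * (1 - t)) := div_nonneg (sq_nonneg _) (by linarith)
  have h3 : t * (a * k) ≤ t * ∑ p, hB.eigenvalues p := by
    rw [hsum]
    gcongr
  have h4 := mul_le_mul_of_nonneg_left hsq hc
  have h5 : t * a - t ^ 2 / (2 * (1 - t)) = (s - 1) ^ 2 + (s - 1) ^ 2 / (2 * s) := by
    have : a = s ^ 2 - 1 := by linarith
    rw [this, ht]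
    field_simp
    ring
  have h6 : 0 ≤ (s - 1) ^ 2 / (2 * s) := by positivity
  have h7 : (s - 1) ^ 2 * k ≤ (t * a - t ^ 2 / (2 * (1 - t))) * k := by
    gcongr
    linarith
  linarith

/-! ### Covering the parameter set -/

/-- Shifting by a small multiple of the identity does not increase the norm of a matrix of positive
trace. -/
theorem frobeniusNorm_sub_smul_one_le {n : Type*} [Fintype n] [DecidableEq n] (W : Matrix n n ℂ)
    {c : ℝ} (hc : 0 ≤ c) (h : c * Fintype.card n ≤ 2 * W.trace.re) :
    frobeniusNorm (W - (c : ℂ) • (1 : Matrix n n ℂ)) ≤ frobeniusNorm W := by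
  refine Real.sqrt_le_sqrt ?_
  have h1 : ∀ i j, ‖(W - (c : ℂ) • (1 : Matrix n n ℂ)) i j‖ ^ 2 =
      ‖W i j‖ ^ 2 + if i = j then c ^ 2 - 2 * c * (W i i).re else 0 := fun i j => by
    rcases eq_or_ne i j with rfl | hij
    · simp only [Matrix.sub_apply, Matrix.smul_apply, one_apply_eq, smul_eq_mul, mul_one, if_true]
      rw [← Complex.normSq_eq_norm_sq, ← Complex.normSq_eq_norm_sq, Complex.normSq_apply,
        Complex.normSq_apply]
      simp
      ring
    · simp [hij]
  simp only [h1, Finset.sum_add_distrib, Finset.sum_ite_eq, Finset.mem_univ, if_true,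
    Finset.sum_sub_distrib, ← Finset.mul_sum, Finset.sum_const, Finset.card_univ, nsmul_eq_mul]
  have h2 : ∑ i, (W i i).re = W.trace.re := by rw [trace, Complex.re_sum]; rfl
  rw [h2]
  nlinarith

/-- A single Hermitian matrix close to all `𝓜 θ` with `θ` in a ball. Its norm and trace satisfy
the same bounds as those of `𝓜 θ`, which hold on a convex set, even though the centre `c` of the
ball need not lie in `Θ`. -/
theorem exists_hermitian_center {n E : Type*} [Fintype n] [NormedAddCommGroup E]
    [InnerProductSpace ℝ E] {Θ T : Set E} {𝓜 : E → Matrix n n ℂ} {α l δ : ℝ}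
    (hΘ : Θ.Nonempty) (hT : T ⊆ Θ)
    (hherm : ∀ θ ∈ Θ, (𝓜 θ).IsHermitian) (hF : ∀ θ ∈ Θ, frobeniusNorm (𝓜 θ) ≤ 1)
    (hα : ∀ θ ∈ Θ, α ≤ (𝓜 θ).trace.re) (hl : 0 ≤ l) (hδ : 0 ≤ δ)
    (hlip : ∀ θ ∈ Θ, ∀ θ' ∈ Θ, frobeniusNorm (𝓜 θ - 𝓜 θ') ≤ l * ‖θ - θ'‖) {c : E}
    (hc : ∀ θ ∈ T, ‖θ - c‖ ≤ δ) :
    ∃ W : Matrix n n ℂ, W.IsHermitian ∧ frobeniusNorm W ≤ 1 ∧ α ≤ W.trace.re ∧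
      ∀ θ ∈ T, frobeniusNorm (𝓜 θ - W) ≤ l * δ := by
  let vec : Matrix n n ℂ → EuclideanSpace ℂ (n × n) := fun A => WithLp.toLp 2 fun p => A p.1 p.2
  have hvec : ∀ A, ‖vec A‖ = frobeniusNorm A := fun A => by
    rw [EuclideanSpace.norm_eq, frobeniusNorm, Fintype.sum_prod_type]
  have hvecsub : ∀ A B, ‖vec A - vec B‖ = frobeniusNorm (A - B) := fun A B => (hvec (A - B))
  let K : Set (EuclideanSpace ℂ (n × n)) := Metric.closedBall 0 1 ∩
    {v | (∀ i j, star (v (j, i)) = v (i, j)) ∧ α ≤ ∑ i, (v (i, i)).re}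
  have hmem : ∀ θ ∈ Θ, vec (𝓜 θ) ∈ K := fun θ hθ => by
    refine ⟨?_, fun i j => (hherm θ hθ).apply i j, ?_⟩
    · rw [mem_closedBall_zero_iff, hvec]
      exact hF θ hθ
    · have := hα θ hθ
      rwa [trace, Complex.re_sum] at this
  have hKcl : IsClosed {v : EuclideanSpace ℂ (n × n) |
      (∀ i j, star (v (j, i)) = v (i, j)) ∧ α ≤ ∑ i, (v (i, i)).re} := by
    refine IsClosed.and ?_ (isClosed_le continuous_const (by fun_prop))
    simp only [Set.ofPred_forall]
    exact isClosed_iInter fun i => isClosed_iInter fun j => isClosed_eq (by fun_prop) (by fun_prop)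
  have hK : IsCompact K := (isCompact_closedBall _ _).inter_right hKcl
  have hKc : Convex ℝ K := by
    refine (convex_closedBall _ _).inter ?_
    rintro v ⟨hv1, hv2⟩ w ⟨hw1, hw2⟩ p q hp hq hpq
    refine ⟨fun i j => ?_, ?_⟩
    · have h1 := hv1 i j
      have h2 := hw1 i j
      simp only [PiLp.add_apply, PiLp.smul_apply, star_add, star_smul, h1, h2, star_trivial]
    · have h1 : ∑ i, ((p • v + q • w) (i, i)).re =
          p * ∑ i, (v (i, i)).re + q * ∑ i, (w (i, i)).re := by
        simp [Finset.sum_add_distrib, Finset.mul_sum]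
      rw [h1]
      calc α = p * α + q * α := by rw [← add_mul, hpq, one_mul]
        _ ≤ _ := by gcongr
  obtain ⟨θ₀, hθ₀⟩ := hΘ
  obtain ⟨w, ⟨hw1, hw2, hw3⟩, hw⟩ := exists_mem_forall_norm_sub_le hK hKc ⟨_, hmem θ₀ hθ₀⟩
    (T := T) (f := fun θ => vec (𝓜 θ)) (fun θ hθ => hmem θ (hT hθ)) hl hδ
    (fun θ hθ θ' hθ' => by rw [hvecsub]; exact hlip θ (hT hθ) θ' (hT hθ')) hc
  let W : Matrix n n ℂ := Matrix.of fun i j => w (i, j)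
  have hW : vec W = w := rfl
  refine ⟨W, ?_, ?_, ?_, fun θ hθ => ?_⟩
  · ext i j
    exact hw2 i j
  · rwa [← hvec, hW, ← mem_closedBall_zero_iff]
  · rw [trace, Complex.re_sum]
    exact hw3
  · rw [← hvecsub, hW]
    exact hw θ hθ

theorem exists_abs_sub_cell_center_le {N : ℕ} (hN : 0 < N) {t : ℝ} (ht : t ∈ Set.Icc (-1 : ℝ) 1) :
    ∃ j : Fin N, |t - (-1 + (2 * (j : ℝ) + 1) / N)| ≤ 1 / N := by
  have hN' : (0 : ℝ) < N := Nat.cast_pos.2 hN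
  set u := (t + 1) / 2 * N with hu
  have hu0 : 0 ≤ u := mul_nonneg (by linarith [ht.1]) hN'.le
  have huN : u ≤ N := by
    have : (t + 1) / 2 ≤ 1 := by linarith [ht.2]
    nlinarith
  have ht' : t = -1 + 2 * u / N := by rw [hu]; field_simp; ring
  obtain ⟨j, hj1, hj2⟩ : ∃ j : Fin N, (j : ℝ) ≤ u ∧ u ≤ j + 1 := by
    rcases lt_or_eq_of_le huN with h | h
    · exact ⟨⟨⌊u⌋₊, (Nat.floor_lt hu0).2 h⟩, Nat.floor_le hu0, (Nat.lt_floor_add_one u).le⟩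
    · refine ⟨⟨N - 1, by omega⟩, ?_, ?_⟩ <;> simp [Nat.cast_sub hN, h]
  refine ⟨j, ?_⟩
  have h1 : t - (-1 + (2 * (j : ℝ) + 1) / N) = (2 * u - (2 * j + 1)) / N := by
    rw [ht']; ring
  rw [h1, abs_div, abs_of_pos hN']
  gcongr
  rw [abs_le]
  constructor <;> linarith

theorem exists_norm_sub_cell_center_le {m N : ℕ} (hN : 0 < N) {θ : EuclideanSpace ℝ (Fin m)}
    (hθ : ∀ i, θ i ∈ Set.Icc (-1 : ℝ) 1) :
    ∃ J : Fin m → Fin N,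
      ‖θ - WithLp.toLp 2 (fun i => -1 + (2 * (J i : ℝ) + 1) / N)‖ ≤ √m / N := by
  choose J hJ using fun i => exists_abs_sub_cell_center_le hN (hθ i)
  refine ⟨J, ?_⟩
  rw [EuclideanSpace.norm_eq, Real.sqrt_le_iff]
  refine ⟨by positivity, ?_⟩
  rw [div_pow, Real.sq_sqrt (Nat.cast_nonneg _)]
  calc ∑ i, ‖(θ - WithLp.toLp 2 (fun i => -1 + (2 * (J i : ℝ) + 1) / (N : ℝ))) i‖ ^ 2
      ≤ ∑ _i : Fin m, (1 / (N : ℝ)) ^ 2 :=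
        Finset.sum_le_sum fun i _ => pow_le_pow_left₀ (norm_nonneg _) (hJ i) 2
    _ = m / (N : ℝ) ^ 2 := by simp; ring

/-- The number of cells per axis is at most `x = 2√m l d / ε`. Here `1 ≤ x` is needed: the ceiling
is `1` for `0 < x ≤ 2`. -/
theorem natCeil_half_le {x : ℝ} (hx : 1 ≤ x) : (⌈x / 2⌉₊ : ℝ) ≤ x := by
  rcases le_total x 2 with h | h
  · have : ⌈x / 2⌉₊ ≤ 1 := Nat.ceil_le.2 (by norm_num; linarith)
    exact (by exact_mod_cast this : (⌈x / 2⌉₊ : ℝ) ≤ 1).trans hx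
  · have := Nat.ceil_lt_add_one (a := x / 2) (by linarith)
    linarith

theorem re_trace_mul_self {n : Type*} [Fintype n] {A : Matrix n n ℂ} (hA : A.IsHermitian) :
    (A * A).trace.re = frobeniusNorm A ^ 2 := by
  rw [frobeniusNorm_sq, trace, Complex.re_sum]
  refine Finset.sum_congr rfl fun i _ => ?_
  rw [diag_apply, mul_apply, Complex.re_sum]
  refine Finset.sum_congr rfl fun j _ => ?_
  rw [← hA.apply j i, Complex.star_def, Complex.mul_conj, Complex.normSq_eq_norm_sq,
    Complex.ofReal_re]

/-- The set of detected states is open, hence measurable, so its mass under the pushforward is that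
of its preimage. -/
theorem detectionCapability_eq {A B : Type*} [Fintype A] [Fintype B] {m : ℕ} (k : ℕ)
    (Θ : Set (EuclideanSpace ℝ (Fin m)))
    (𝓜 : EuclideanSpace ℝ (Fin m) → Matrix (A × B) (A × B) ℂ) :
    detectionCapability k Θ 𝓜 = (uniformPureState ((A × B) × Fin k)).real
      {φ | ∃ θ ∈ Θ, (partialTrace (pureState φ.1) * 𝓜 θ).trace.re < 0} := by
  have hopen : IsOpen {ρ : (A × B) → (A × B) → ℂ |
      ∃ θ ∈ Θ, (∑ i, ∑ j, ρ i j * 𝓜 θ j i).re < 0} := by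
    have h : {ρ : (A × B) → (A × B) → ℂ | ∃ θ ∈ Θ, (∑ i, ∑ j, ρ i j * 𝓜 θ j i).re < 0} =
        ⋃ θ ∈ Θ, {ρ | (∑ i, ∑ j, ρ i j * 𝓜 θ j i).re < 0} := by
      ext ρ
      simp
    rw [h]
    exact isOpen_biUnion fun θ _ => isOpen_lt (by fun_prop) continuous_const
  have hmeas : MeasurableSet {ρ : Matrix (A × B) (A × B) ℂ |
      ∃ θ ∈ Θ, (ρ * 𝓜 θ).trace.re < 0} := hopen.measurableSet
  rw [detectionCapability, inducedDistribution,
    map_measureReal_apply (measurable_reducedState _ k) hmeas]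
  rfl

/-- The union bound over the `N ^ m` cells of the cube, each represented by one Hermitian
matrix. -/
theorem detectionCapability_le {A B : Type*} [Fintype A] [Fintype B] [Nonempty A] [Nonempty B]
    {m k : ℕ} (hk : 0 < k) {Θ : Set (EuclideanSpace ℝ (Fin m))} (hΘ : Θ.Nonempty)
    {𝓜 : EuclideanSpace ℝ (Fin m) → Matrix (A × B) (A × B) ℂ}
    (hcube : ∀ θ ∈ Θ, ∀ i, θ i ∈ Set.Icc (-1 : ℝ) 1)
    (hherm : ∀ θ ∈ Θ, (𝓜 θ).IsHermitian) (hF : ∀ θ ∈ Θ, frobeniusNorm (𝓜 θ) ≤ 1)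
    {α l ε : ℝ} (hα : ∀ θ ∈ Θ, α ≤ (𝓜 θ).trace.re) (hl : 0 ≤ l)
    (hlip : ∀ θ ∈ Θ, ∀ θ' ∈ Θ, frobeniusNorm (𝓜 θ - 𝓜 θ') ≤ l * ‖θ - θ'‖)
    (hε : 0 < ε) (hεα : ε ≤ α) {N : ℕ} (hN : 0 < N)
    (hlN : l * (√m / N) * (Fintype.card (A × B) : ℝ) ≤ ε) :
    detectionCapability k Θ 𝓜 ≤ (N : ℝ) ^ m * Real.exp (-((√(1 + α - ε) - 1) ^ 2 * k)) := by
  classical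
  have : Nonempty (Fin k) := ⟨⟨0, hk⟩⟩
  have hprob := isProbabilityMeasure_uniformPureState ((A × B) × Fin k)
  set d : ℝ := (Fintype.card (A × B) : ℝ) with hd
  have hdpos : 0 < d := Nat.cast_pos.2 Fintype.card_pos
  set δ := √m / (N : ℝ) with hδ
  have hδ0 : 0 ≤ δ := by positivity
  let c : (Fin m → Fin N) → EuclideanSpace ℝ (Fin m) := fun J =>
    WithLp.toLp 2 (fun i => -1 + (2 * (J i : ℝ) + 1) / N)
  choose W hWherm hWF hWα hW using fun J => exists_hermitian_center (T := {θ ∈ Θ | ‖θ - c J‖ ≤ δ})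
    hΘ (Set.sep_subset _ _) hherm hF hα hl hδ0 hlip (c := c J) (fun θ hθ => hθ.2)
  -- A state detected in the cell of `J` has negative expectation in `W J` lowered by `ε / d`.
  let V : (Fin m → Fin N) → Matrix (A × B) (A × B) ℂ := fun J =>
    W J - ((ε / d : ℝ) : ℂ) • (1 : Matrix (A × B) (A × B) ℂ)
  have hVherm : ∀ J, (V J).IsHermitian := fun J => by
    refine (hWherm J).sub ?_
    rw [IsHermitian, conjTranspose_smul, conjTranspose_one, Complex.star_def, Complex.conj_ofReal]
  have hVF : ∀ J, frobeniusNorm (V J) ≤ 1 := fun J => by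
    refine (frobeniusNorm_sub_smul_one_le (W J) (by positivity) ?_).trans (hWF J)
    rw [← hd, div_mul_cancel₀ _ hdpos.ne']
    linarith [hWα J]
  have hVtr : ∀ J, α - ε ≤ (V J).trace.re := fun J => by
    have h1 : (V J).trace = (W J).trace - ((ε : ℝ) : ℂ) := by
      simp only [V]
      rw [trace_sub, trace_smul, trace_one, smul_eq_mul, ← Complex.ofReal_natCast,
        ← Complex.ofReal_mul, ← hd, div_mul_cancel₀ _ hdpos.ne']
    rw [h1, Complex.sub_re, Complex.ofReal_re]
    linarith [hWα J]
  rw [detectionCapability_eq]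
  have hsub : {φ : Metric.sphere (0 : EuclideanSpace ℂ ((A × B) × Fin k)) 1 |
      ∃ θ ∈ Θ, (partialTrace (pureState φ.1) * 𝓜 θ).trace.re < 0} ⊆
      ⋃ J, {φ | (partialTrace (pureState φ.1) * V J).trace.re < 0} := by
    rintro φ ⟨θ, hθ, hneg⟩
    obtain ⟨J, hJ⟩ := exists_norm_sub_cell_center_le hN (hcube θ hθ)
    refine Set.mem_iUnion.2 ⟨J, ?_⟩
    have hφ : ‖φ.1‖ = 1 := mem_sphere_zero_iff_norm.1 φ.2
    set ρ := partialTrace (pureState φ.1) with hρ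
    have h1 : |(ρ * (𝓜 θ - W J)).trace.re| ≤ ε / d := by
      have h2 := norm_trace_partialTrace_pureState_mul_le φ.1 (𝓜 θ - W J)
      rw [hφ, one_pow, one_mul] at h2
      refine (Complex.abs_re_le_norm _).trans (h2.trans ((hW J θ ⟨hθ, hJ⟩).trans ?_))
      rwa [le_div_iff₀ hdpos]
    have h3 : ρ.trace = 1 := by
      rw [hρ, trace_partialTrace_pureState, hφ]
      simp
    have h4 : (ρ * V J).trace.re =
        (ρ * 𝓜 θ).trace.re - (ρ * (𝓜 θ - W J)).trace.re - ε / d := by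
      simp only [V]
      rw [Matrix.mul_sub, Matrix.mul_sub, Matrix.mul_smul, Matrix.mul_one, trace_sub, trace_sub,
        trace_smul, h3]
      simp
    change (ρ * V J).trace.re < 0
    rw [h4]
    linarith [(abs_le.1 h1).1]
  refine (measureReal_mono hsub).trans ((measureReal_iUnion_fintype_le _).trans ?_)
  calc ∑ J, (uniformPureState ((A × B) × Fin k)).real
        {φ | (partialTrace (pureState φ.1) * V J).trace.re < 0}
      ≤ ∑ _J : Fin m → Fin N, Real.exp (-((√(1 + (α - ε)) - 1) ^ 2 * k)) :=
        Finset.sum_le_sum fun J _ => uniformPureState_expectation_neg_le hk (hVherm J) (hVF J)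
          (by linarith) (hVtr J)
    _ = _ := by
        rw [Finset.sum_const, Finset.card_univ, Fintype.card_fun, Fintype.card_fin,
          Fintype.card_fin, nsmul_eq_mul, Nat.cast_pow, add_sub_assoc]

end EntanglementDetection

theorem theorem3 (dA dB k m : ℕ) (hdA : 0 < dA) (hdB : 0 < dB) (hk : 0 < k)
    (Θ : Set (EuclideanSpace ℝ (Fin m))) (hΘ : Θ.Nonempty)
    (𝓜 : EuclideanSpace ℝ (Fin m) → Matrix (Fin dA × Fin dB) (Fin dA × Fin dB) ℂ)
    (h𝓜 : EntanglementDetection.IsParameterizedEW Θ 𝓜)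
    (l : ℝ)
    (hl : ∀ θ ∈ Θ, ∀ θ' ∈ Θ,
      EntanglementDetection.frobeniusNorm (𝓜 θ - 𝓜 θ') ≤ l * ‖θ - θ'‖)
    (ε : ℝ) (hε0 : 0 < ε) (hε1 : ε < 1)
    (hreg : 1 ≤ 2 * √(m : ℝ) * l * ((dA : ℝ) * (dB : ℝ)) / ε) :
    IsGLB ((fun θ => (𝓜 θ).trace.re) '' Θ) (EntanglementDetection.alphaMin Θ 𝓜) ∧
    1 ≤ EntanglementDetection.alphaMin Θ 𝓜 ∧
    EntanglementDetection.detectionCapability k Θ 𝓜 <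
      2 * Real.exp ((m : ℝ) * Real.log (2 * √(m : ℝ) * l * ((dA : ℝ) * (dB : ℝ)) / ε)
        - (√(1 + EntanglementDetection.alphaMin Θ 𝓜 - ε) - 1) ^ 2 * (k : ℝ)) := by
  have hdA' : (0 : ℝ) < dA := Nat.cast_pos.2 hdA
  have hdB' : (0 : ℝ) < dB := Nat.cast_pos.2 hdB
  have : Nonempty (Fin dA) := ⟨⟨0, hdA⟩⟩
  have : Nonempty (Fin dB) := ⟨⟨0, hdB⟩⟩
  have hα : EntanglementDetection.alphaMin Θ 𝓜 = sInf ((fun θ => (𝓜 θ).trace.re) '' Θ) := by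
    rw [EntanglementDetection.alphaMin]
    congr 1
    refine Set.image_congr fun θ hθ => ?_
    rw [EntanglementDetection.re_trace_mul_self (h𝓜.witness θ hθ).1, h𝓜.normalized θ hθ]
    simp
  have hone : ∀ θ ∈ Θ, 1 ≤ (𝓜 θ).trace.re := fun θ hθ => by
    rw [← h𝓜.normalized θ hθ]
    exact (h𝓜.witness θ hθ).frobeniusNorm_le_trace
  have hglb : IsGLB ((fun θ => (𝓜 θ).trace.re) '' Θ) (EntanglementDetection.alphaMin Θ 𝓜) := by
    rw [hα]
    refine isGLB_csInf (hΘ.image _) ⟨1, ?_⟩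
    rintro _ ⟨θ, hθ, rfl⟩
    exact hone θ hθ
  have hα1 : 1 ≤ EntanglementDetection.alphaMin Θ 𝓜 := by
    refine (le_isGLB_iff hglb).2 ?_
    rintro _ ⟨θ, hθ, rfl⟩
    exact hone θ hθ
  refine ⟨hglb, hα1, ?_⟩
  set α := EntanglementDetection.alphaMin Θ 𝓜
  set x := 2 * √(m : ℝ) * l * ((dA : ℝ) * (dB : ℝ)) / ε with hx
  have hxpos : 0 < x := one_pos.trans_le hreg
  have hl0 : 0 ≤ l := by
    by_contra! h
    have : x ≤ 0 := div_nonpos_of_nonpos_of_nonneg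
      (mul_nonpos_of_nonpos_of_nonneg
        (mul_nonpos_of_nonneg_of_nonpos (by positivity) h.le) (by positivity)) hε0.le
    linarith
  set N := ⌈x / 2⌉₊ with hNdef
  have hN : 0 < N := Nat.ceil_pos.2 (by positivity)
  have hN' : (0 : ℝ) < N := Nat.cast_pos.2 hN
  have hlN : l * (√m / N) * (Fintype.card (Fin dA × Fin dB) : ℝ) ≤ ε := by
    have h1 : x / 2 ≤ N := Nat.le_ceil _
    have h2 : x / 2 * ε = l * √m * (dA * dB) := by
      rw [hx]
      field_simp
    have h3 : x / 2 * ε ≤ N * ε := by gcongr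
    rw [Fintype.card_prod, Fintype.card_fin, Fintype.card_fin, Nat.cast_mul]
    calc l * (√m / N) * (dA * dB) = l * √m * (dA * dB) / N := by ring
      _ ≤ ε := by rw [div_le_iff₀ hN', ← h2]; linarith
  -- The shift `ε` stays below `α` because `ε < 1 ≤ α`.
  have hmain := EntanglementDetection.detectionCapability_le hk hΘ h𝓜.mem_cube
    (fun θ hθ => (h𝓜.witness θ hθ).1) (fun θ hθ => (h𝓜.normalized θ hθ).le)
    (fun θ hθ => hglb.1 ⟨θ, hθ, rfl⟩) hl0 hl hε0 (hε1.le.trans hα1) hN hlN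
  have hpow : (N : ℝ) ^ m ≤ Real.exp (m * Real.log x) := by
    rw [← Real.log_pow, Real.exp_log (by positivity)]
    exact pow_le_pow_left₀ hN'.le (EntanglementDetection.natCeil_half_le hreg) m
  rw [sub_eq_add_neg, Real.exp_add]
  set y := Real.exp (-((√(1 + α - ε) - 1) ^ 2 * k))
  have hy : 0 < y := Real.exp_pos _
  have h1 := mul_le_mul_of_nonneg_right hpow hy.le
  have h2 : 0 < Real.exp (m * Real.log x) * y := by positivity
  linarith
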